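/- Work in ZFC. Let $\kappa$ be a measurable cardinal and let $\vec U=\langle\kappa\rangle^\frown\langle U_\alpha\mid\alpha<\ell(\vec U)\rangle$ be a measure sequence on $\kappa$: each $U_\alpha$ is a ($\kappa$-complete, nonprincipal, normal) measure on $V_\kappa$, and there are a transitive class $M$ and an elementary embedding $j:V\to M$ with critical point $\kappa$ such that for every $\beta<\ell(\vec U)$ the initial segment $\vec U\restriction\beta=\langle\kappa\rangle^\frown\langle U_\alpha\mid\alpha<\beta\rangle$ belongs to $M$ and $U_\beta=\{X\subseteq V_\kappa\mid \vec U\restriction\beta\in j(X)\}$. For a measure sequence $\bar\mu$ on $\nu$ write $\kappa(\bar\mu)=\nu$, let $\bigcap\bar\mu$ be the set of those $X\subseteq V_\nu$ that belong to all measures of $\bar\mu$, and let $\bigcup\bar\mu$ be the set of those that belong to at least one. Let $\mathcal{MS}_\nu$ be the set of measure sequences in $V_\nu$ (on measurable cardinals below $\nu$), and put $\mathcal{MS}=\mathcal{MS}_\kappa$. Assume that $\mathcal{MS}\in\bigcap\vec U$. A measure $U_\rho$ $(\rho<\ell(\vec U))$ is a repeat point of $\vec U$ if $U_\alpha\subseteq\bigcup_{i<\rho}U_i$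 for every $\alpha$ with $\rho\le\alpha<\ell(\vec U)$; $\vec U$ satisfies RP if it has a repeat point. A measure function on $\nu$ is a function $b:\mathcal{MS}_\nu\to V_\nu$ with $b(\bar\mu)\in\bigcap\bar\mu$ for all $\bar\mu$. For $\bar\mu\in\mathcal{MS}_\nu$ put $X_{b,\bar\mu}=\{\bar\eta\in\mathcal{MS}_\nu\mid\bar\mu\in b(\bar\eta)\}$. For a measure sequence $\vec u$ on $\nu$ (or an initial segment of one), a repeat filter of $b$ with respect to $\vec u$ is a $\nu$-complete filter $W$ on $\mathcal{MS}_\nu$ such that (a) $\{\bar\mu\in\mathcal{MS}_\nu\mid\kappa(\bar\mu)>\alpha\}\in W$ for every $\alpha<\nu$; (b) $W\subseteq\bigcup\vec u$; (c) for every $\bar\mu\in\mathcal{MS}_\nu$, either $X_{b,\bar\mu}\in W$ or $\mathcal{MS}_\nu\setminus X_{b,\bar\mu}\in W$; (d) $[b]_W=\{\bar\mu\in\mathcal{MS}_\nu\mid X_{b,\bar\mu}\in W\}\in\bigcap\vec u$. The sequence $\vec u$ satisfies the Weak Repeat Property (WRP) if every measure function on $\nu$ has a repeat filter with respect to $\vec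 u$. Then: 1. If $\vec U$ satisfies RP, then $\vec U$ satisfies WRP. 2. If $U_\rho$ is a repeat point of $\vec U$, then $\{\bar\mu\in\mathcal{MS}\mid\bar\mu\text{ satisfies WRP}\}\in U_\rho$, and there is $\tau<\rho$ such that $\vec U\restriction\tau$ satisfies WRP. -/

import Mathlib

open ZFSet
open scoped FirstOrder

universe u

namespace Radin

/-! The universe `V` is `ZFSet.{u}`; inner models are transitive classes `M : Set ZFSet.{u}`. -/

/-- The only symbol of the language of set theory: a binary relation symbol. -/
inductive SetRel : ℕ → Type
  | mem : SetRel 2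

/-- The first-order language of set theory. -/
def setLang : FirstOrder.Language.{0, 0} := ⟨fun _ => Empty, SetRel⟩

/-- The universe as an `∈`-structure. -/
instance universeStructure : setLang.Structure ZFSet.{u} where
  funMap f := Empty.elim f
  RelMap r x := match r, x with
    | SetRel.mem, x => x 0 ∈ x 1

/-- A class of sets as an `∈`-structure. -/
instance classStructure (M : Set ZFSet.{u}) : setLang.Structure M where
  funMap f := Empty.elim f
  RelMap r x := match r, x with
    | SetRel.mem, x => (x 0 : ZFSet.{u}) ∈ (x 1 : ZFSet.{u})

/-- `M` is a transitive class. -/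
def IsTransitiveClass (M : Set ZFSet.{u}) : Prop := ∀ x ∈ M, ∀ y ∈ x, y ∈ M

/-- `F` is a proper `κ`-complete filter on the set `S`: it is closed under intersections of
nonempty families of fewer than `κ` members. -/
structure IsCompleteFilter (κ : Ordinal.{u}) (S F : ZFSet.{u}) : Prop where
  subset_of_mem : ∀ X ∈ F, X ⊆ S
  base_mem : S ∈ F
  empty_notMem : ∅ ∉ F
  upward : ∀ X ∈ F, ∀ Y : ZFSet.{u}, X ⊆ Y → Y ⊆ S → Y ∈ F
  complete : ∀ A : ZFSet.{u}, A ⊆ F → A.Nonempty → ZFSet.card A < κ.card → ⋂₀ A ∈ F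

/-- `F` is a nonprincipal `κ`-complete ultrafilter on the set `S`. -/
structure IsCompleteUltrafilter (κ : Ordinal.{u}) (S F : ZFSet.{u}) : Prop
    extends IsCompleteFilter κ S F where
  ultra : ∀ X : ZFSet.{u}, X ⊆ S → X ∈ F ∨ S \ X ∈ F
  nonprincipal : ∀ x ∈ S, ({x} : ZFSet.{u}) ∉ F

/-- `κ` is a measurable cardinal: an uncountable cardinal (identified with its initial ordinal)
carrying a nonprincipal `κ`-complete ultrafilter. -/
def IsMeasurableCardinal (κ : Ordinal.{u}) : Prop :=
  κ.card.ord = κ ∧ Ordinal.omega0 < κ ∧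
    ∃ D : ZFSet.{u}, IsCompleteUltrafilter κ κ.toZFSet D

/-- The sequence `⟨κ⟩ ⌢ ⟨U α | α < ℓ⟩`, as a set: the function with domain `1 + ℓ` which
takes the value `κ` at `0` and `U α` at `1 + α`. Only the values of `U` below `ℓ` matter. -/
noncomputable def mkSeq (κ ℓ : Ordinal.{u}) (U : Ordinal.{u} → ZFSet.{u}) : ZFSet.{u} :=
  insert (pair (Ordinal.toZFSet 0) κ.toZFSet)
    (ZFSet.range fun α : Set.Iio ℓ => pair (Ordinal.toZFSet (1 + α.1)) (U α.1))

theorem mem_mkSeq {κ ℓ : Ordinal.{u}} {U : Ordinal.{u} → ZFSet.{u}} {x : ZFSet.{u}} :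
    x ∈ mkSeq κ ℓ U ↔ x = pair (Ordinal.toZFSet 0) κ.toZFSet ∨
      ∃ α < ℓ, x = pair (Ordinal.toZFSet (1 + α)) (U α) := by
  simp [mkSeq, eq_comm]

/-- A sequence determines its first entry, its length and its measures. -/
theorem mkSeq_inj {κ ℓ κ' ℓ' : Ordinal.{u}} {U U' : Ordinal.{u} → ZFSet.{u}} :
    mkSeq κ ℓ U = mkSeq κ' ℓ' U' ↔ κ = κ' ∧ ℓ = ℓ' ∧ ∀ α < ℓ, U α = U' α := by
  have h0 : ∀ α : Ordinal.{u}, (1 + α : Ordinal.{u}) ≠ 0 := fun α h => by simp at h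
  have key : ∀ {κ ℓ κ' ℓ' : Ordinal.{u}} {U U' : Ordinal.{u} → ZFSet.{u}},
      mkSeq κ ℓ U = mkSeq κ' ℓ' U' → κ = κ' ∧ ∀ α < ℓ, α < ℓ' ∧ U α = U' α := by
    intro κ ℓ κ' ℓ' U U' h
    refine ⟨?_, fun α hα => ?_⟩
    · have := (mem_mkSeq (x := pair (Ordinal.toZFSet 0) κ.toZFSet)).1
        (h ▸ mem_mkSeq.2 (Or.inl rfl))
      rcases this with h1 | ⟨β, -, h1⟩
      · exact Ordinal.toZFSet_injective (pair_inj.1 h1).2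
      · exact absurd (Ordinal.toZFSet_injective (pair_inj.1 h1).1).symm (h0 β)
    · have := (mem_mkSeq (x := pair (Ordinal.toZFSet (1 + α)) (U α))).1
        (h ▸ mem_mkSeq.2 (Or.inr ⟨α, hα, rfl⟩))
      rcases this with h1 | ⟨β, hβ, h1⟩
      · exact absurd (Ordinal.toZFSet_injective (pair_inj.1 h1).1) (h0 α)
      · have e : α = β := by
          have := Ordinal.toZFSet_injective (pair_inj.1 h1).1
          exact (add_right_inj (1 : Ordinal.{u})).1 this
        subst e
        exact ⟨hβ, (pair_inj.1 h1).2⟩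
  constructor
  · intro h
    obtain ⟨h1, h2⟩ := key h
    obtain ⟨-, h3⟩ := key h.symm
    refine ⟨h1, le_antisymm ?_ ?_, fun α hα => (h2 α hα).2⟩
    · exact le_of_forall_lt fun α hα => (h2 α hα).1
    · exact le_of_forall_lt fun α hα => (h3 α hα).1
  · rintro ⟨rfl, rfl, h⟩
    ext x
    simp only [mem_mkSeq]
    refine or_congr_right (exists_congr fun α => and_congr_right fun hα => by rw [h α hα])

/-- The diagonal intersection of `⟨A i | i < κ⟩`: the sequences `x = ⟨ν⟩ ⌢ ⟨u_i | i < l⟩` in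
`V_κ` that belong to `A i` for every `i < ν`. -/
noncomputable def diagInter (κ : Ordinal.{u}) (A : Ordinal.{u} → ZFSet.{u}) : ZFSet.{u} :=
  ZFSet.sep (fun x => ∃ (ν l : Ordinal.{u}) (u : Ordinal.{u} → ZFSet.{u}),
    x = mkSeq ν l u ∧ ∀ i < ν, x ∈ A i) (V_ κ)

/-- `D` is a measure on `V_κ`: a (nonprincipal) `κ`-complete normal ultrafilter on `V_κ`. -/
structure IsMeasureOn (κ : Ordinal.{u}) (D : ZFSet.{u}) : Prop
    extends IsCompleteUltrafilter κ (V_ κ) D where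
  normal : ∀ A : Ordinal.{u} → ZFSet.{u}, (∀ i < κ, A i ∈ D) → diagInter κ A ∈ D

/-- The elementary embedding `j : V → M` has critical point `κ`. -/
def HasCriticalPoint {M : Set ZFSet.{u}} (j : ZFSet.{u} ↪ₑ[setLang] M) (κ : Ordinal.{u}) : Prop :=
  (∀ α < κ, (j α.toZFSet : ZFSet.{u}) = α.toZFSet) ∧ (j κ.toZFSet : ZFSet.{u}) ≠ κ.toZFSet

/-- `⟨κ⟩ ⌢ ⟨U α | α < ℓ⟩` is a measure sequence on the measurable cardinal `κ`: every `U α` is a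
measure on `V_κ`, and there is an elementary `j : V → M` into a transitive class, with critical
point `κ`, such that for every `β < ℓ` the initial segment `U ↾ β` belongs to `M` and
`U β = {X ⊆ V_κ | U ↾ β ∈ j(X)}`. -/
def IsMeasureSequence (κ ℓ : Ordinal.{u}) (U : Ordinal.{u} → ZFSet.{u}) : Prop :=
  IsMeasurableCardinal κ ∧ (∀ α < ℓ, IsMeasureOn κ (U α)) ∧
    ∃ (M : Set ZFSet.{u}) (j : ZFSet.{u} ↪ₑ[setLang] M),
      IsTransitiveClass M ∧ HasCriticalPoint j κ ∧
        ∀ β < ℓ, mkSeq κ β U ∈ M ∧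
          ∀ X : ZFSet.{u}, X ∈ U β ↔ X ⊆ V_ κ ∧ mkSeq κ β U ∈ (j X : ZFSet.{u})

/-- `MS κ`: the set of the measure sequences in `V_κ` (on measurable cardinals below `κ`). -/
noncomputable def MS (κ : Ordinal.{u}) : ZFSet.{u} :=
  ZFSet.sep (fun s => ∃ (ν l : Ordinal.{u}) (u : Ordinal.{u} → ZFSet.{u}),
    ν < κ ∧ IsMeasureSequence ν l u ∧ s = mkSeq ν l u) (V_ κ)

/-- `⋂ U`, the filter on `V_κ` of the sets that belong to `U α` for all `α < ℓ`
(for `ℓ = 0`, all subsets of `V_κ`). -/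
noncomputable def interSeq (κ ℓ : Ordinal.{u}) (U : Ordinal.{u} → ZFSet.{u}) : ZFSet.{u} :=
  ZFSet.sep (fun X => ∀ α < ℓ, X ∈ U α) (powerset (V_ κ))

/-- `⋃ U`, the family of the subsets of `V_κ` that belong to `U α` for some `α < ℓ`. -/
noncomputable def unionSeq (κ ℓ : Ordinal.{u}) (U : Ordinal.{u} → ZFSet.{u}) : ZFSet.{u} :=
  ZFSet.sep (fun X => ∃ α < ℓ, X ∈ U α) (powerset (V_ κ))

/-- `U ρ` is a repeat point of `U`: `U α ⊆ ⋃_{i < ρ} U i` for every `α ≥ ρ` (`α < ℓ`). -/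
def IsRepeatPoint (κ ℓ : Ordinal.{u}) (U : Ordinal.{u} → ZFSet.{u}) (ρ : Ordinal.{u}) : Prop :=
  ρ < ℓ ∧ ∀ α, ρ ≤ α → α < ℓ → U α ⊆ unionSeq κ ρ U

/-- The Repeat Property. -/
def RP (κ ℓ : Ordinal.{u}) (U : Ordinal.{u} → ZFSet.{u}) : Prop :=
  ∃ ρ, IsRepeatPoint κ ℓ U ρ

/-- `b` (restricted to `MS κ`) is a measure function: `b μ ∈ ⋂ μ` for every `μ ∈ MS κ`.
Then `b μ ⊆ V_ν` with `ν < κ`, so `b` maps `MS κ` to `V_κ`. -/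
def IsMeasureFunction (κ : Ordinal.{u}) (b : ZFSet.{u} → ZFSet.{u}) : Prop :=
  ∀ (ν l : Ordinal.{u}) (u : Ordinal.{u} → ZFSet.{u}),
    mkSeq ν l u ∈ MS κ → b (mkSeq ν l u) ∈ interSeq ν l u

/-- `X_{b,μ} = {ν ∈ MS κ | μ ∈ b ν}`. -/
noncomputable def fiber (κ : Ordinal.{u}) (b : ZFSet.{u} → ZFSet.{u}) (μ : ZFSet.{u}) :
    ZFSet.{u} :=
  ZFSet.sep (fun ν => μ ∈ b ν) (MS κ)

/-- `W` measures `b`: it decides every `X_{b,μ}`. -/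
def Measures (κ : Ordinal.{u}) (W : ZFSet.{u}) (b : ZFSet.{u} → ZFSet.{u}) : Prop :=
  ∀ μ ∈ MS κ, fiber κ b μ ∈ W ∨ MS κ \ fiber κ b μ ∈ W

/-- `[b]_W = {μ ∈ MS κ | X_{b,μ} ∈ W}`. -/
noncomputable def filterValue (κ : Ordinal.{u}) (W : ZFSet.{u}) (b : ZFSet.{u} → ZFSet.{u}) :
    ZFSet.{u} :=
  ZFSet.sep (fun μ => fiber κ b μ ∈ W) (MS κ)

/-- `W` extends the co-bounded filter on `MS κ`. -/
def ExtendsCobounded (κ : Ordinal.{u}) (W : ZFSet.{u}) : Prop :=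
  ∀ α < κ, ZFSet.sep (fun μ => ∃ (ν l : Ordinal.{u}) (u : Ordinal.{u} → ZFSet.{u}),
    μ = mkSeq ν l u ∧ α < ν) (MS κ) ∈ W

/-- `W` is a repeat filter of `b` with respect to `U`. -/
structure IsRepeatFilter (κ ℓ : Ordinal.{u}) (U : Ordinal.{u} → ZFSet.{u})
    (b : ZFSet.{u} → ZFSet.{u}) (W : ZFSet.{u}) : Prop where
  completeFilter : IsCompleteFilter κ (MS κ) W
  extendsCobounded : ExtendsCobounded κ W
  subset_unionSeq : W ⊆ unionSeq κ ℓ U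
  measures : Measures κ W b
  value_mem : filterValue κ W b ∈ interSeq κ ℓ U

/-- The Weak Repeat Property: every measure function has a repeat filter. -/
def WRP (κ ℓ : Ordinal.{u}) (U : Ordinal.{u} → ZFSet.{u}) : Prop :=
  ∀ b : ZFSet.{u} → ZFSet.{u}, IsMeasureFunction κ b → ∃ W, IsRepeatFilter κ ℓ U b W

/-- The set of the measure sequences in `MS κ` that satisfy the Weak Repeat Property. -/
noncomputable def wrpSet (κ : Ordinal.{u}) : ZFSet.{u} :=
  ZFSet.sep (fun s => ∃ (ν l : Ordinal.{u}) (u : Ordinal.{u} → ZFSet.{u}),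
    s = mkSeq ν l u ∧ WRP ν l u) (MS κ)

open Classical in
/-- The Weak Repeat Property is meaningful only for sequences whose measures concentrate on
measure sequences: it implies `MS κ ∈ ⋂ U`. -/
theorem MS_mem_interSeq_of_WRP (κ ℓ : Ordinal.{u}) (U : Ordinal.{u} → ZFSet.{u})
    (hU : IsMeasureSequence κ ℓ U) (h : WRP κ ℓ U) : MS κ ∈ interSeq κ ℓ U := by
  have hs : MS κ ⊆ V_ κ := fun x hx => (mem_sep.1 hx).1
  obtain ⟨W, hW⟩ := h (fun s => if h : ∃ ν l u, s = mkSeq ν l u then V_ h.choose else ∅) (by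
    intro ν l u hm
    have he : ∃ ν' l' u', mkSeq ν l u = mkSeq ν' l' u' := ⟨ν, l, u, rfl⟩
    have h1 : he.choose = ν := by
      obtain ⟨l', u', h'⟩ := he.choose_spec
      exact (mkSeq_inj.1 h').1.symm
    beta_reduce
    rw [dif_pos he]
    rw [h1]
    obtain ⟨_, ν', l', u', _, hms, hh⟩ := mem_sep.1 hm
    obtain ⟨rfl, rfl, h3⟩ := mkSeq_inj.1 hh
    refine mem_sep.2 ⟨by simp, fun α hα => ?_⟩
    rw [h3 α hα]; exact (hms.2.1 α hα).base_mem)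
  have := mem_sep.1 hW.value_mem
  refine mem_sep.2 ⟨mem_powerset.2 hs, fun α hα => ?_⟩
  exact (hU.2.1 α hα).upward _ (this.2 α hα) _ (fun x hx => (mem_sep.1 hx).1) hs

end Radin

/-!
The argument replaces repeat filters by their generators. Let `T = MS κ`, let `b` be a measure
function on `T`, and let `s` be a measure sequence on `ν ≤ κ`. A *guess* for `b` at `s` is a set
`A ⊆ T` in `⋂ s` such that for all `α < ν` and `a ∈ V_ν` the set
`B = {η | κ(η) > α, b(η) and A agree on T ∩ a}` is in `⋃ s`. If `b` has a guess `A` at `s`, the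
sets `B` generate a `ν`-complete filter, because `ν` is regular; this is a repeat filter of `b`
whose value includes `A` (`WRP_of_combWRP`). So the Weak Repeat Property follows from the
existence of guesses for all measure functions, `CombWRP`, and unlike the former the property
"`A` is a guess" is `Δ₀` in `T`, `s` and a code of `b` (`IsDeltaZero.hasGuess`).

Let `j : V → M` generate `U`. It fixes the elements of `V_κ`
(`IsDeltaZeroElementary.mem_of_mem_vonNeumann`), and whether a set is a guess at `U ↾ τ` depends
only on the parts of `T` and `b` in `V_κ` (`HasGuess.congr`). Since `Δ₀` relations are preserved
by `j` and absolute for `M`, the set of the `s ∈ T` with `CombWRP` belongs to `U_τ` if and only if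
`U ↾ τ` has `CombWRP` (`Generates.combWRP_set_mem_iff`). No closure property of `M` is needed: a
guess is a member of a measure in the sequence, so `M` contains it by transitivity.

If `U_ρ` is a repeat point, then `j(b)(U ↾ ρ)` is a guess for `b` at `U` and at `U ↾ ρ`
(`Generates.combWRP_of_isRepeatPoint`). This gives the first claim and, by reflection, the first
half of the second. The set of the `s` with `CombWRP` is then in `U_ρ ⊆ ⋃_{i < ρ} U_i`, hence in
some `U_τ` with `τ < ρ`, and reflection in the other direction gives the property for `U ↾ τ`.
-/

namespace Radin

/-! ### `Δ₀` relations and elementary embeddings -/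

/-- `P` is a `Δ₀` relation of the variables `v 0, v 1, …`, in the form in which it is used here:
one formula of set theory defines `P` in the universe and in every transitive class. -/
def IsDeltaZero (P : (ℕ → ZFSet.{u}) → Prop) : Prop :=
  ∃ φ : setLang.Formula ℕ, (∀ v : ℕ → ZFSet.{u}, φ.Realize v ↔ P v) ∧
    ∀ M : Set ZFSet.{u}, IsTransitiveClass M → ∀ v : ℕ → M, φ.Realize v ↔ P fun n => v n

namespace IsDeltaZero

variable {P Q : (ℕ → ZFSet.{u}) → Prop}

theorem mem (i k : ℕ) : IsDeltaZero fun v : ℕ → ZFSet.{u} => v i ∈ v k := by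
  refine ⟨FirstOrder.Language.Relations.formula₂ (L := setLang) SetRel.mem (.var i) (.var k),
    fun v => ?_, fun M _ v => ?_⟩
  · exact FirstOrder.Language.Formula.realize_rel₂.trans Iff.rfl
  · exact FirstOrder.Language.Formula.realize_rel₂.trans Iff.rfl

theorem eq (i k : ℕ) : IsDeltaZero fun v : ℕ → ZFSet.{u} => v i = v k := by
  refine ⟨FirstOrder.Language.Term.equal (.var i) (.var k), fun v => ?_, fun M _ v => ?_⟩
  · simp
  · simp [Subtype.ext_iff]

theorem not (hP : IsDeltaZero P) : IsDeltaZero fun v => ¬ P v := by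
  obtain ⟨φ, h1, h2⟩ := hP
  exact ⟨φ.not, fun v => by simp [h1], fun M hM v => by simp [h2 M hM]⟩

theorem and (hP : IsDeltaZero P) (hQ : IsDeltaZero Q) : IsDeltaZero fun v => P v ∧ Q v := by
  obtain ⟨φ, h1, h2⟩ := hP
  obtain ⟨ψ, h3, h4⟩ := hQ
  exact ⟨φ ⊓ ψ, fun v => by simp [h1, h3], fun M hM v => by simp [h2 M hM, h4 M hM]⟩

theorem imp (hP : IsDeltaZero P) (hQ : IsDeltaZero Q) : IsDeltaZero fun v => P v → Q v := by
  obtain ⟨φ, h1, h2⟩ := hP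
  obtain ⟨ψ, h3, h4⟩ := hQ
  exact ⟨φ.imp ψ, fun v => by simp [h1, h3], fun M hM v => by simp [h2 M hM, h4 M hM]⟩

theorem congr (hP : IsDeltaZero P) (h : ∀ v, Q v ↔ P v) : IsDeltaZero Q := by
  rwa [show Q = P from funext fun v => propext (h v)]

theorem iff (hP : IsDeltaZero P) (hQ : IsDeltaZero Q) : IsDeltaZero fun v => P v ↔ Q v :=
  ((hP.imp hQ).and (hQ.imp hP)).congr fun _ => iff_iff_implies_and_implies

theorem or (hP : IsDeltaZero P) (hQ : IsDeltaZero Q) : IsDeltaZero fun v => P v ∨ Q v :=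
  (hP.not.imp hQ).congr fun _ => or_iff_not_imp_left

/-- Bounded quantification; inside the quantifier the bound variable is `w 0`, and the free
variables are shifted by one. -/
theorem bex (i : ℕ) {P : ZFSet.{u} → (ℕ → ZFSet.{u}) → Prop}
    (hP : IsDeltaZero fun w => P (w 0) fun n => w (n + 1)) :
    IsDeltaZero fun v => ∃ y ∈ v i, P y v := by
  obtain ⟨φ, h1, h2⟩ := ((mem 0 (i + 1)).and hP)
  refine ⟨.iExs Unit (φ.relabel fun n => Nat.casesOn n (Sum.inr ()) Sum.inl),
    fun v => ?_, fun M hM v => ?_⟩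
  · rw [FirstOrder.Language.Formula.realize_iExs]
    constructor
    · rintro ⟨y, hy⟩
      rw [FirstOrder.Language.Formula.realize_relabel, h1] at hy
      exact ⟨y (), hy⟩
    · rintro ⟨y, hy⟩
      refine ⟨fun _ => y, ?_⟩
      rw [FirstOrder.Language.Formula.realize_relabel, h1]
      exact hy
  · rw [FirstOrder.Language.Formula.realize_iExs]
    constructor
    · rintro ⟨y, hy⟩
      rw [FirstOrder.Language.Formula.realize_relabel, h2 M hM] at hy
      exact ⟨y (), hy⟩
    · rintro ⟨y, hy⟩
      refine ⟨fun _ => ⟨y, hM _ (v i).2 _ hy.1⟩, ?_⟩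
      rw [FirstOrder.Language.Formula.realize_relabel, h2 M hM]
      exact hy

theorem ball (i : ℕ) {P : ZFSet.{u} → (ℕ → ZFSet.{u}) → Prop}
    (hP : IsDeltaZero fun w => P (w 0) fun n => w (n + 1)) :
    IsDeltaZero fun v => ∀ y ∈ v i, P y v :=
  (bex i (P := fun y v => ¬ P y v) hP.not).not.congr fun _ => by push Not; rfl

theorem eq_empty (i : ℕ) : IsDeltaZero fun v : ℕ → ZFSet.{u} => v i = ∅ :=
  (bex i (P := fun y _ => y = y) (eq 0 0)).not.congr fun v => by simp [ZFSet.eq_empty]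

theorem eq_pair (p a b : ℕ) : IsDeltaZero fun v : ℕ → ZFSet.{u} => v p = pair (v a) (v b) := by
  have e : ∀ q a b : ZFSet.{u}, (a ∈ q ∧ b ∈ q ∧ ∀ z ∈ q, z = a ∨ z = b) ↔ q = {a, b} := by
    intro q a b
    constructor
    · rintro ⟨h1, h2, h3⟩
      ext z
      rw [mem_pair]
      exact ⟨h3 z, by rintro (rfl | rfl) <;> assumption⟩
    · rintro rfl
      simp
  have key : ∀ q a b : ℕ, IsDeltaZero fun v : ℕ → ZFSet.{u} => v q = {v a, v b} := fun q a b =>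
    ((mem a q).and ((mem b q).and (ball q (P := fun z v => z = v a ∨ z = v b)
      ((eq 0 (a + 1)).or (eq 0 (b + 1)))))).congr fun v => (e _ _ _).symm
  refine ((bex p (P := fun q v => q = {v a, v a}) (key 0 (a + 1) (a + 1))).and
    ((bex p (P := fun q v => q = {v a, v b}) (key 0 (a + 1) (b + 1))).and
    (ball p (P := fun q v => q = {v a, v a} ∨ q = {v a, v b})
      ((key 0 (a + 1) (a + 1)).or (key 0 (a + 1) (b + 1)))))).congr fun v => ?_
  simp only [pair]
  constructor
  · intro h
    simp [h]
  · rintro ⟨⟨q, hq, rfl⟩, ⟨r, hr, rfl⟩, h⟩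
    ext z
    rw [mem_pair]
    refine ⟨fun hz => by simpa using h z hz, ?_⟩
    rintro (rfl | rfl)
    · simpa using hq
    · exact hr

theorem pair_mem (a b g : ℕ) :
    IsDeltaZero fun v : ℕ → ZFSet.{u} => pair (v a) (v b) ∈ v g :=
  (bex g (P := fun p v => p = pair (v a) (v b)) (eq_pair 0 (a + 1) (b + 1))).congr fun v => by
    simp

end IsDeltaZero

/-- A class function preserving all `Δ₀` relations. This is all that the proof uses of an
elementary embedding into a transitive class. -/
def IsDeltaZeroElementary (J : ZFSet.{u} → ZFSet.{u}) : Prop :=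
  ∀ P : (ℕ → ZFSet.{u}) → Prop, IsDeltaZero P → ∀ v, P v ↔ P fun n => J (v n)

theorem isDeltaZeroElementary_coe {M : Set ZFSet.{u}} (hM : IsTransitiveClass M)
    (j : ZFSet.{u} ↪ₑ[setLang] M) : IsDeltaZeroElementary fun x => (j x : ZFSet.{u}) := by
  rintro P ⟨φ, h1, h2⟩ v
  rw [← h1, ← j.map_formula, h2 M hM]
  rfl

namespace IsDeltaZeroElementary

variable {J : ZFSet.{u} → ZFSet.{u}}

/-- The transfer of a `Δ₀` relation of six parameters (fewer, if some of them are ignored). -/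
theorem transfer (hJ : IsDeltaZeroElementary J) (a b c d e f : ZFSet.{u})
    {R : ZFSet.{u} → ZFSet.{u} → ZFSet.{u} → ZFSet.{u} → ZFSet.{u} → ZFSet.{u} → Prop}
    (hR : IsDeltaZero fun v => R (v 0) (v 1) (v 2) (v 3) (v 4) (v 5)) :
    R a b c d e f ↔ R (J a) (J b) (J c) (J d) (J e) (J f) :=
  hJ _ hR fun n => [a, b, c, d, e, f].getD n ∅

theorem mem_iff (hJ : IsDeltaZeroElementary J) {a b : ZFSet.{u}} : J a ∈ J b ↔ a ∈ b :=
  (hJ.transfer a b ∅ ∅ ∅ ∅ (R := fun a b _ _ _ _ => a ∈ b) (.mem 0 1)).symm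

theorem injective (hJ : IsDeltaZeroElementary J) : Function.Injective J := fun a b =>
  (hJ.transfer a b ∅ ∅ ∅ ∅ (R := fun a b _ _ _ _ => a = b) (.eq 0 1)).2

theorem subset (hJ : IsDeltaZeroElementary J) {a b : ZFSet.{u}} (h : a ⊆ b) : J a ⊆ J b :=
  fun _ hz => (hJ.transfer a b ∅ ∅ ∅ ∅ (R := fun a b _ _ _ _ => ∀ z ∈ a, z ∈ b)
    (.ball 0 (.mem 0 2))).1 (fun _ hz => h hz) _ hz

theorem pair (hJ : IsDeltaZeroElementary J) (a b : ZFSet.{u}) :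
    J (pair a b) = ZFSet.pair (J a) (J b) :=
  (hJ.transfer (ZFSet.pair a b) a b ∅ ∅ ∅ (R := fun p a b _ _ _ => p = ZFSet.pair a b)
    (.eq_pair 0 1 2)).1 rfl

end IsDeltaZeroElementary

/-- An elementary embedding that fixes the ordinals below `κ` fixes the levels `V_α`, `α < κ`,
pointwise. The induction runs over the function `γ ↦ V_γ` on `α`: its image is a function with
the same values, by the induction hypothesis, and it still exhausts the image of `V_α`. -/
theorem IsDeltaZeroElementary.mem_of_mem_vonNeumann {J : ZFSet.{u} → ZFSet.{u}}
    (hJ : IsDeltaZeroElementary J) {κ : Ordinal.{u}} (hκ : ∀ α < κ, J α.toZFSet = α.toZFSet)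
    (α : Ordinal.{u}) (hα : α < κ) : ∀ z ∈ J (V_ α), z ∈ V_ α ∧ J z = z := by
  induction α using WellFoundedLT.induction with
  | ind α ih =>
  intro z hz
  set f : ZFSet.{u} := ZFSet.range fun γ : Set.Iio α => ZFSet.pair γ.1.toZFSet (V_ γ.1) with hf
  have cover := (hJ.transfer (V_ α) α.toZFSet f ∅ ∅ ∅
    (R := fun V o f _ _ _ => ∀ z ∈ V, ∃ γ ∈ o, ∃ p ∈ f, ∃ q ∈ p, ∃ Y ∈ q,
      p = ZFSet.pair γ Y ∧ ∀ w ∈ z, w ∈ Y)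
    (.ball 0 (.bex 2 (.bex 4 (.bex 0 (.bex 0 (.and (.eq_pair 2 3 0)
      (.ball 4 (.mem 0 1))))))))).1 (by
      intro z hz
      obtain ⟨γ, hγ, hzγ⟩ := mem_vonNeumann'.1 hz
      exact ⟨_, Ordinal.toZFSet_mem_toZFSet_iff.2 hγ, _, mem_range.2 ⟨⟨γ, hγ⟩, rfl⟩,
        {γ.toZFSet, V_ γ}, by simp [ZFSet.pair], V_ γ, by simp, rfl, fun w hw => hzγ hw⟩)
  obtain ⟨γ', hγ', p, hp, q, hq, Y, hY, rfl, hzY⟩ := cover z hz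
  rw [hκ α hα] at hγ'
  obtain ⟨γ, hγ, rfl⟩ := Ordinal.mem_toZFSet_iff.1 hγ'
  have value := (hJ.transfer f γ.toZFSet (V_ γ) ∅ ∅ ∅
    (R := fun f o V _ _ _ => ∀ p ∈ f, ∀ q ∈ p, ∀ Y ∈ q, p = ZFSet.pair o Y → Y = V)
    (.ball 0 (.ball 0 (.ball 0 (.imp (.eq_pair 2 4 0) (.eq 0 5)))))).1 (by
      intro p hp q _ Y _ e
      obtain ⟨δ, rfl⟩ := mem_range.1 hp
      obtain ⟨h1, h2⟩ := pair_inj.1 e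
      rw [← h2, Ordinal.toZFSet_injective h1])
  obtain rfl := value _ hp q hq Y hY (by rw [hκ γ (hγ.trans hα)])
  have ihγ := ih γ hγ (hγ.trans hα)
  have hzV : z ⊆ V_ γ := fun w hw => (ihγ w (hzY w hw)).1
  refine ⟨mem_vonNeumann'.2 ⟨γ, hγ, hzV⟩, ?_⟩
  ext w
  constructor
  · intro hw
    have h := (ihγ w (hJ.subset hzV hw)).2
    rw [← h] at hw
    exact hJ.mem_iff.1 hw
  · intro hw
    have h := (ihγ w (hzY w hw)).2
    rw [← h]
    exact hJ.mem_iff.2 hw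

theorem IsDeltaZeroElementary.apply_eq_self {J : ZFSet.{u} → ZFSet.{u}}
    (hJ : IsDeltaZeroElementary J) {κ : Ordinal.{u}} (hκ : ∀ α < κ, J α.toZFSet = α.toZFSet)
    (hlim : Order.IsSuccPrelimit κ) {x : ZFSet.{u}} (hx : x ∈ V_ κ) : J x = x := by
  have h1 : Order.succ (rank x) < κ := hlim.succ_lt (mem_vonNeumann.1 hx)
  exact hJ.injective
    (hJ.mem_of_mem_vonNeumann hκ _ h1 _ (hJ.mem_iff.2 (mem_vonNeumann_succ x))).2

/-! ### A `Δ₀` form of the Weak Repeat Property -/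

/-- `Y` is one of the measures of the sequence `s`: it is the value of `s` at a nonempty index. -/
def IsEntry (s Y : ZFSet.{u}) : Prop :=
  ∃ p ∈ s, ∃ q ∈ p, ∃ a ∈ q, Y ∈ q ∧ p = pair a Y ∧ a ≠ ∅

/-- `α` is an element of `κ(s)`, the value of the sequence `s` at `∅`. -/
def BelowFirst (s α : ZFSet.{u}) : Prop :=
  ∃ p ∈ s, ∃ q ∈ p, ∃ ν ∈ q, ∃ e ∈ q, e = ∅ ∧ p = pair e ν ∧ α ∈ ν

/-- For a set `T` of measure sequences, `g` codes a measure function on `T` (up to supersets):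
for every `η ∈ T`, the set `{x | (η, x) ∈ g}` includes a member of each measure of `η`. -/
def CodesMeasureFunction (T g : ZFSet.{u}) : Prop :=
  ∀ η ∈ T, ∀ Y, IsEntry η Y → ∃ X ∈ Y, ∀ x ∈ X, pair η x ∈ g

/-- `η ∈ T` lies above `α`, and the value at `η` of the function coded by `g` agrees with `A` on
the members of `T` in `a`. -/
def Agrees (T g A α a η : ZFSet.{u}) : Prop :=
  η ∈ T ∧ BelowFirst η α ∧ ∀ μ ∈ a, μ ∈ T → (pair η μ ∈ g ↔ μ ∈ A)

/-- Some `A ⊆ T` in `⋂ s` is such that for all `α < κ(s)` and `a ∈ V_{κ(s)}` the set of the `η`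
that agree with `A` on `a` above `α` is in `⋃ s`. Here `V_{κ(s)}` is described as the union of the
members of the measures of `s`, which keeps all quantifiers bounded. -/
def HasGuess (T s g : ZFSet.{u}) : Prop :=
  ∃ Y, IsEntry s Y ∧ ∃ A ∈ Y, (∀ Z, IsEntry s Z → A ∈ Z) ∧ (∀ x ∈ A, x ∈ T) ∧
    ∀ α, BelowFirst s α → ∀ Z, IsEntry s Z → ∀ V ∈ Z, ∀ a ∈ V,
      ∃ Z', IsEntry s Z' ∧ ∃ X ∈ Z', ∀ η ∈ X, Agrees T g A α a η

/-- The combinatorial form of the Weak Repeat Property of `s`, relative to a set `T` of measure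
sequences: every measure function on `T` has a guess. -/
def CombWRP (T s : ZFSet.{u}) : Prop :=
  ∀ g, CodesMeasureFunction T g → HasGuess T s g

namespace IsDeltaZero

theorem subst {P : (ℕ → ZFSet.{u}) → Prop} (hP : IsDeltaZero P) (σ : ℕ → ℕ) :
    IsDeltaZero fun v => P fun n => v (σ n) := by
  obtain ⟨φ, h1, h2⟩ := hP
  refine ⟨φ.relabel σ, fun v => ?_, fun M hM v => ?_⟩
  · rw [FirstOrder.Language.Formula.realize_relabel, h1]; rfl
  · rw [FirstOrder.Language.Formula.realize_relabel, h2 M hM]; rfl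

theorem isEntry (s Y : ℕ) : IsDeltaZero fun v : ℕ → ZFSet.{u} => IsEntry (v s) (v Y) :=
  .bex s (.bex 0 (.bex 0 (.and (.mem (Y + 3) 1) (.and (.eq_pair 2 0 (Y + 3))
    (.not (.eq_empty 0))))))

theorem belowFirst (s α : ℕ) : IsDeltaZero fun v : ℕ → ZFSet.{u} => BelowFirst (v s) (v α) :=
  .bex s (.bex 0 (.bex 0 (.bex 1 (.and (.eq_empty 0) (.and (.eq_pair 3 0 1)
    (.mem (α + 4) 1))))))

theorem exists_isEntry (i : ℕ) {P : ZFSet.{u} → (ℕ → ZFSet.{u}) → Prop}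
    (hP : IsDeltaZero fun w => P (w 0) fun n => w (n + 1)) :
    IsDeltaZero fun v => ∃ Y, IsEntry (v i) Y ∧ P Y v := by
  have h : IsDeltaZero fun v => ∃ p ∈ v i, ∃ q ∈ p, ∃ Y ∈ q, IsEntry (v i) Y ∧ P Y v :=
    .bex i (.bex 0 (.bex 0 (.and (.isEntry (i + 3) 0)
      (hP.subst fun n => Nat.casesOn n 0 fun k => k + 3))))
  refine h.congr fun v => ⟨?_, ?_⟩
  · rintro ⟨Y, hY, hPY⟩
    obtain ⟨p, hp, q, hq, a, -, hYq, -⟩ := id hY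
    exact ⟨p, hp, q, hq, Y, hYq, hY, hPY⟩
  · rintro ⟨-, -, -, -, Y, -, h⟩
    exact ⟨Y, h⟩

theorem forall_isEntry (i : ℕ) {P : ZFSet.{u} → (ℕ → ZFSet.{u}) → Prop}
    (hP : IsDeltaZero fun w => P (w 0) fun n => w (n + 1)) :
    IsDeltaZero fun v => ∀ Y, IsEntry (v i) Y → P Y v :=
  (exists_isEntry i (P := fun Y v => ¬ P Y v) hP.not).not.congr fun _ => by push Not; rfl

theorem forall_belowFirst (i : ℕ) {P : ZFSet.{u} → (ℕ → ZFSet.{u}) → Prop}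
    (hP : IsDeltaZero fun w => P (w 0) fun n => w (n + 1)) :
    IsDeltaZero fun v => ∀ α, BelowFirst (v i) α → P α v := by
  have h : IsDeltaZero fun v =>
      ∀ p ∈ v i, ∀ q ∈ p, ∀ ν ∈ q, ∀ α ∈ ν, BelowFirst (v i) α → P α v :=
    .ball i (.ball 0 (.ball 0 (.ball 0 (.imp (.belowFirst (i + 4) 0)
      (hP.subst fun n => Nat.casesOn n 0 fun k => k + 4)))))
  refine h.congr fun v => ⟨fun h _ _ _ _ _ _ α _ => h α, fun h α hα => ?_⟩
  obtain ⟨p, hp, q, hq, ν, hν, -, -, -, -, hαν⟩ := id hα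
  exact h p hp q hq ν hν α hαν hα

theorem codesMeasureFunction (T g : ℕ) :
    IsDeltaZero fun v : ℕ → ZFSet.{u} => CodesMeasureFunction (v T) (v g) :=
  .ball T (.forall_isEntry 0 (.bex 0 (.ball 0 (.pair_mem 3 0 (g + 4)))))

theorem agrees (T g A α a η : ℕ) : IsDeltaZero fun v : ℕ → ZFSet.{u} =>
    Agrees (v T) (v g) (v A) (v α) (v a) (v η) :=
  .and (.mem η T) (.and (.belowFirst η α) (.ball a (.imp (.mem 0 (T + 1))
    (.iff (.pair_mem (η + 1) 0 (g + 1)) (.mem 0 (A + 1))))))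

theorem hasGuess (T s g : ℕ) :
    IsDeltaZero fun v : ℕ → ZFSet.{u} => HasGuess (v T) (v s) (v g) :=
  .exists_isEntry s (.bex 0 (.and (.forall_isEntry (s + 2) (.mem 1 0))
    (.and (.ball 0 (.mem 0 (T + 3))) (.forall_belowFirst (s + 2)
      (.forall_isEntry (s + 3) (.ball 0 (.ball 0 (.exists_isEntry (s + 6) (.bex 0 (.ball 0
        (.agrees (T + 9) (g + 9) 7 6 3 0)))))))))))

end IsDeltaZero

theorem isEntry_mkSeq {ν l : Ordinal.{u}} {u : Ordinal.{u} → ZFSet.{u}} {Y : ZFSet.{u}} :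
    IsEntry (mkSeq ν l u) Y ↔ ∃ α < l, Y = u α := by
  constructor
  · rintro ⟨p, hp, q, -, a, -, -, rfl, ha⟩
    rcases mem_mkSeq.1 hp with h | ⟨α, hα, h⟩
    · exact absurd ((pair_inj.1 h).1.trans (by simp)) ha
    · exact ⟨α, hα, (pair_inj.1 h).2⟩
  · rintro ⟨α, hα, rfl⟩
    refine ⟨_, mem_mkSeq.2 (.inr ⟨α, hα, rfl⟩), {(1 + α).toZFSet, u α}, by simp [pair], _,
      by simp, by simp, rfl, fun h => ?_⟩
    have h' := Ordinal.toZFSet_injective (h.trans Ordinal.toZFSet_zero.symm)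
    simp at h'

theorem belowFirst_mkSeq {ν l : Ordinal.{u}} {u : Ordinal.{u} → ZFSet.{u}} {α : ZFSet.{u}} :
    BelowFirst (mkSeq ν l u) α ↔ α ∈ ν.toZFSet := by
  constructor
  · rintro ⟨p, hp, q, -, ν', -, e, -, he, rfl, hα⟩
    rcases mem_mkSeq.1 hp with h | ⟨β, -, h⟩
    · rwa [(pair_inj.1 h).2] at hα
    · have h' := Ordinal.toZFSet_injective
        (((pair_inj.1 h).1.symm.trans he).trans Ordinal.toZFSet_zero.symm)
      simp at h'
  · intro h
    exact ⟨_, mem_mkSeq.2 (.inl rfl), {Ordinal.toZFSet 0, ν.toZFSet}, by simp [pair], _,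
      by simp, _, by simp, Ordinal.toZFSet_zero, rfl, h⟩

theorem hasGuess_mkSeq {T g : ZFSet.{u}} {ν l : Ordinal.{u}} {u : Ordinal.{u} → ZFSet.{u}}
    (hu : ∀ i < l, IsMeasureOn ν (u i)) :
    HasGuess T (mkSeq ν l u) g ↔ 0 < l ∧ ∃ A ⊆ T, (∀ i < l, A ∈ u i) ∧
      ∀ α < ν, ∀ a ∈ V_ ν, ∃ i < l, ∃ X ∈ u i, ∀ η ∈ X, Agrees T g A α.toZFSet a η := by
  constructor
  · rintro ⟨Y, hY, A, -, hA, hAT, h⟩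
    obtain ⟨i, hi, rfl⟩ := isEntry_mkSeq.1 hY
    refine ⟨pos_of_gt hi, A, hAT, fun k hk => hA _ (isEntry_mkSeq.2 ⟨k, hk, rfl⟩),
      fun α hα a ha => ?_⟩
    obtain ⟨Z, hZ, X, hX, hη⟩ := h α.toZFSet
      (belowFirst_mkSeq.2 (Ordinal.toZFSet_mem_toZFSet_iff.2 hα)) _ hY _ (hu i hi).base_mem a ha
    obtain ⟨k, hk, rfl⟩ := isEntry_mkSeq.1 hZ
    exact ⟨k, hk, X, hX, hη⟩
  · rintro ⟨hl, A, hAT, hA, h⟩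
    refine ⟨u 0, isEntry_mkSeq.2 ⟨0, hl, rfl⟩, A, hA 0 hl, fun Z hZ => ?_, hAT,
      fun α hα Z hZ V hV a ha => ?_⟩
    · obtain ⟨k, hk, rfl⟩ := isEntry_mkSeq.1 hZ
      exact hA k hk
    · obtain ⟨k, hk, rfl⟩ := isEntry_mkSeq.1 hZ
      obtain ⟨β, hβ, rfl⟩ := Ordinal.mem_toZFSet_iff.1 (belowFirst_mkSeq.1 hα)
      obtain ⟨i, hi, X, hX, hη⟩ := h β hβ a ((hu k hk).subset_of_mem V hV ha)
      exact ⟨u i, isEntry_mkSeq.2 ⟨i, hi, rfl⟩, X, hX, hη⟩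

/-- Whether `⟨κ⟩ ⌢ U` has a guess depends only on the parts of `T` and `g` inside `V_κ`. -/
theorem HasGuess.congr {T T' g g' : ZFSet.{u}} {κ l : Ordinal.{u}}
    {U : Ordinal.{u} → ZFSet.{u}} (hU : ∀ i < l, IsMeasureOn κ (U i))
    (hT : ∀ x ∈ V_ κ, x ∈ T ↔ x ∈ T')
    (hg : ∀ x ∈ V_ κ, ∀ y ∈ V_ κ, pair x y ∈ g ↔ pair x y ∈ g')
    (h : HasGuess T (mkSeq κ l U) g) : HasGuess T' (mkSeq κ l U) g' := by
  rw [hasGuess_mkSeq hU] at h ⊢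
  obtain ⟨hl, A, hAT, hA, h⟩ := h
  have hAV : A ⊆ V_ κ := (hU 0 hl).subset_of_mem A (hA 0 hl)
  refine ⟨hl, A, fun x hx => (hT x (hAV hx)).1 (hAT hx), hA, fun α hα a ha => ?_⟩
  obtain ⟨i, hi, X, hX, hη⟩ := h α hα a ha
  refine ⟨i, hi, X, hX, fun η hηX => ?_⟩
  have hηV := (hU i hi).subset_of_mem X hX hηX
  obtain ⟨h1, h2, h3⟩ := hη η hηX
  refine ⟨(hT _ hηV).1 h1, h2, fun μ hμ hμT => ?_⟩
  have hμV := (isTransitive_vonNeumann κ).mem_trans hμ ha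
  rw [← hg _ hηV _ hμV]
  exact h3 μ hμ ((hT _ hμV).2 hμT)

/-! ### Repeat filters from guesses -/

theorem IsCompleteFilter.inter_mem {κ : Ordinal.{u}} {S F : ZFSet.{u}}
    (hF : IsCompleteFilter κ S F) (hκ : Cardinal.aleph0 ≤ κ.card) {X Y : ZFSet.{u}} (hX : X ∈ F)
    (hY : Y ∈ F) : X ∩ Y ∈ F := by
  have h := hF.complete {X, Y} (by intro z; simp only [mem_pair]; rintro (rfl | rfl) <;> assumption)
    ⟨X, by simp⟩ (lt_of_lt_of_le (lt_of_le_of_lt card_insert_le (by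
      rw [card_singleton]; exact_mod_cast Cardinal.natCast_lt_aleph0 (n := 2))) hκ)
  refine hF.upward _ h _ (fun z hz => ?_) fun z hz => hF.subset_of_mem X hX (mem_inter.1 hz).1
  exact mem_inter.2 ⟨mem_of_mem_sInter hz (by simp), mem_of_mem_sInter hz (by simp)⟩

namespace IsMeasurableCardinal

variable {κ : Ordinal.{u}}

theorem aleph0_le (hκ : IsMeasurableCardinal κ) : Cardinal.aleph0 ≤ κ.card := by
  rw [← Cardinal.ord_le_ord, hκ.1, Cardinal.ord_aleph0]
  exact hκ.2.1.le

theorem isSuccLimit (hκ : IsMeasurableCardinal κ) : Order.IsSuccLimit κ := by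
  rw [← hκ.1]
  exact Cardinal.isSuccLimit_ord hκ.aleph0_le

/-- The regularity of a measurable cardinal, for families of ordinals indexed by a set. -/
theorem exists_bound (hκ : IsMeasurableCardinal κ) {S : ZFSet.{u}} (hS : card S < κ.card)
    (f : ZFSet.{u} → Ordinal.{u}) (hf : ∀ x ∈ S, f x < κ) : ∃ γ < κ, ∀ x ∈ S, f x ≤ γ := by
  obtain ⟨h1, h2, D, hD⟩ := hκ
  have cobounded : ∀ δ < κ, κ.toZFSet \ δ.toZFSet ∈ D := by
    intro δ hδ
    rcases eq_or_ne δ 0 with rfl | hδ0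
    · rw [show κ.toZFSet \ Ordinal.toZFSet 0 = κ.toZFSet by ext; simp]
      exact hD.base_mem
    let _ : Definable₁ fun x : ZFSet.{u} => κ.toZFSet \ {x} := Classical.allZFSetDefinable _
    have h := hD.complete (ZFSet.image (fun x => κ.toZFSet \ {x}) δ.toZFSet) ?_ ?_ ?_
    · refine hD.upward _ h _ (fun z hz => ?_) fun z hz => (mem_sdiff.1 hz).1
      have hz' : ∀ i ∈ δ.toZFSet, z ∈ κ.toZFSet \ {i} := fun i hi =>
        mem_of_mem_sInter hz (mem_image.2 ⟨i, hi, rfl⟩)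
      have h0 : Ordinal.toZFSet 0 ∈ δ.toZFSet :=
        Ordinal.toZFSet_mem_toZFSet_iff.2 (pos_iff_ne_zero.2 hδ0)
      refine mem_sdiff.2 ⟨(mem_sdiff.1 (hz' _ h0)).1, fun hzδ => ?_⟩
      exact (mem_sdiff.1 (hz' z hzδ)).2 (mem_singleton.2 rfl)
    · intro y hy
      obtain ⟨i, hi, rfl⟩ := mem_image.1 hy
      have hiκ : i ∈ κ.toZFSet := Ordinal.toZFSet_subset_toZFSet_iff.2 hδ.le hi
      refine (hD.ultra {i} fun z hz => ?_).resolve_left (hD.nonprincipal i hiκ)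
      rwa [mem_singleton.1 hz]
    · exact ⟨_, mem_image.2 ⟨_, Ordinal.toZFSet_mem_toZFSet_iff.2 (pos_iff_ne_zero.2 hδ0), rfl⟩⟩
    · refine lt_of_le_of_lt card_image_le ?_
      rw [Ordinal.card_toZFSet]
      rwa [← h1, Cardinal.lt_ord] at hδ
  rcases eq_empty_or_nonempty S with rfl | ⟨x₀, hx₀⟩
  · exact ⟨0, pos_of_gt h2, by simp⟩
  let _ : Definable₁ fun x : ZFSet.{u} => κ.toZFSet \ (f x).toZFSet :=
    Classical.allZFSetDefinable _
  have h := hD.complete (ZFSet.image (fun x => κ.toZFSet \ (f x).toZFSet) S) (fun y hy => by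
      obtain ⟨x, hx, rfl⟩ := mem_image.1 hy
      exact cobounded _ (hf x hx))
    ⟨_, mem_image.2 ⟨x₀, hx₀, rfl⟩⟩ (lt_of_le_of_lt card_image_le hS)
  rcases eq_empty_or_nonempty
    (⋂₀ (ZFSet.image (fun x => κ.toZFSet \ (f x).toZFSet) S)) with he | ⟨z, hz⟩
  · exact absurd (he ▸ h) hD.empty_notMem
  have hz' : ∀ x ∈ S, z ∈ κ.toZFSet \ (f x).toZFSet := fun x hx =>
    mem_of_mem_sInter hz (mem_image.2 ⟨x, hx, rfl⟩)
  obtain ⟨γ, hγ, rfl⟩ := Ordinal.mem_toZFSet_iff.1 (mem_sdiff.1 (hz' x₀ hx₀)).1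
  refine ⟨γ, hγ, fun x hx => not_lt.1 fun hlt => ?_⟩
  exact (mem_sdiff.1 (hz' x hx)).2 (Ordinal.toZFSet_mem_toZFSet_iff.2 hlt)

end IsMeasurableCardinal

theorem mem_MS_iff_of_le {ν κ : Ordinal.{u}} (h : ν ≤ κ) {η : ZFSet.{u}} (hη : η ∈ V_ ν) :
    η ∈ MS ν ↔ η ∈ MS κ := by
  constructor
  · intro hm
    obtain ⟨-, ν', l, u, h1, h2, h3⟩ := mem_sep.1 hm
    exact mem_sep.2 ⟨vonNeumann_subset_of_le h hη, ν', l, u, h1.trans_le h, h2, h3⟩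
  · intro hm
    obtain ⟨-, ν', l, u, -, h2, rfl⟩ := mem_sep.1 hm
    refine mem_sep.2 ⟨hη, ν', l, u, ?_, h2, rfl⟩
    have h1 : ν'.toZFSet ∈ ({Ordinal.toZFSet 0, ν'.toZFSet} : ZFSet.{u}) := by simp
    have h2 : ({Ordinal.toZFSet 0, ν'.toZFSet} : ZFSet.{u}) ∈
      pair (Ordinal.toZFSet 0) ν'.toZFSet := by simp [pair]
    have h3 : pair (Ordinal.toZFSet 0) ν'.toZFSet ∈ mkSeq ν' l u := mem_mkSeq.2 (.inl rfl)
    have := (rank_lt_of_mem h1).trans ((rank_lt_of_mem h2).trans (rank_lt_of_mem h3))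
    rw [Ordinal.rank_toZFSet] at this
    exact this.trans (mem_vonNeumann.1 hη)

/-- The combinatorial form implies the Weak Repeat Property: for a guess `A`, the sets of the `η`
that agree with `A` on `a` above `α` generate a repeat filter. It is `ν`-complete because `ν` is
regular and the parameters `α`, `a` of fewer than `ν` generators can be joined, and its value is
`A` or larger. -/
theorem WRP_of_combWRP {ν κ l : Ordinal.{u}} {u : Ordinal.{u} → ZFSet.{u}} (hνκ : ν ≤ κ)
    (hu : IsMeasureSequence ν l u) (h : CombWRP (MS κ) (mkSeq ν l u)) : WRP ν l u := by
  intro b hb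
  have hlim := hu.1.isSuccLimit
  have hsub : MS ν ⊆ V_ ν := fun x hx => (mem_sep.1 hx).1
  -- The code of `b`, extended by the values `V_{κ(η)}` outside of `MS ν`.
  obtain ⟨hl, A, hAT, hA, hguess⟩ := (hasGuess_mkSeq hu.2.1).1 (h
    (ZFSet.sep (fun p => ∃ η x, p = pair η x ∧ (η ∈ MS ν → x ∈ b η))
      (prod (V_ κ) (V_ κ))) (by
    intro η hη Y hY
    obtain ⟨hηV, ν', l', u', hν', hu', rfl⟩ := mem_sep.1 hη
    obtain ⟨i, hi, rfl⟩ := isEntry_mkSeq.1 hY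
    by_cases hm : mkSeq ν' l' u' ∈ MS ν
    · obtain ⟨hbV, hbm⟩ := mem_sep.1 (hb ν' l' u' hm)
      refine ⟨_, hbm i hi, fun x hx => mem_sep.2 ⟨pair_mem_prod.2 ⟨hηV, ?_⟩, _, _, rfl,
        fun _ => hx⟩⟩
      exact vonNeumann_subset_of_le hν'.le (mem_powerset.1 hbV hx)
    · exact ⟨V_ ν', (hu'.2.1 i hi).base_mem, fun x hx => mem_sep.2 ⟨pair_mem_prod.2 ⟨hηV,
        vonNeumann_subset_of_le hν'.le hx⟩, _, _, rfl, fun h => absurd h hm⟩⟩))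
  set g := ZFSet.sep (fun p => ∃ η x, p = pair η x ∧ (η ∈ MS ν → x ∈ b η))
    (prod (V_ κ) (V_ κ)) with hg
  have mem_g : ∀ η ∈ MS ν, ∀ μ ∈ V_ ν, pair η μ ∈ g ↔ μ ∈ b η := by
    intro η hη μ hμ
    rw [hg, mem_sep, pair_mem_prod]
    constructor
    · rintro ⟨-, η', x, e, hx⟩
      obtain ⟨rfl, rfl⟩ := pair_inj.1 e
      exact hx hη
    · exact fun hx => ⟨⟨vonNeumann_subset_of_le hνκ (hsub hη), vonNeumann_subset_of_le hνκ hμ⟩,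
        η, μ, rfl, fun _ => hx⟩
  set B : Ordinal.{u} → ZFSet.{u} → ZFSet.{u} := fun α a =>
    ZFSet.sep (fun η => Agrees (MS κ) g A α.toZFSet a η) (MS ν) with hB
  have mem_B : ∀ {α a η}, η ∈ B α a ↔ η ∈ MS ν ∧ Agrees (MS κ) g A α.toZFSet a η :=
    fun {_ _ _} => mem_sep
  have B_sub : ∀ α a, B α a ⊆ MS ν := fun α a η hη => (mem_B.1 hη).1
  have B_large : ∀ α < ν, ∀ a ∈ V_ ν, ∃ i < l, B α a ∈ u i := by
    intro α hα a ha
    obtain ⟨i, hi, X, hX, hη⟩ := hguess α hα a ha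
    have hXV := (hu.2.1 i hi).subset_of_mem X hX
    refine ⟨i, hi, (hu.2.1 i hi).upward X hX _ (fun η hηX => ?_)
      fun η hη => hsub (B_sub _ _ hη)⟩
    exact mem_B.2 ⟨(mem_MS_iff_of_le hνκ (hXV hηX)).2 (hη η hηX).1, hη η hηX⟩
  have B_mono : ∀ {α α' a a'}, α ≤ α' → a ⊆ a' → B α' a' ⊆ B α a := by
    intro α α' a a' hα ha η hη
    obtain ⟨h1, h2, h3, h4⟩ := mem_B.1 hη
    refine mem_B.2 ⟨h1, h2, ?_, fun μ hμ => h4 μ (ha hμ)⟩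
    obtain ⟨-, ν', l', u', -, -, rfl⟩ := mem_sep.1 h1
    rw [belowFirst_mkSeq, Ordinal.toZFSet_mem_toZFSet_iff] at h3 ⊢
    exact hα.trans_lt h3
  have h0 : ∅ ∈ V_ ν := mem_vonNeumann.2 (by simpa using hlim.bot_lt)
  set W : ZFSet.{u} :=
    ZFSet.sep (fun X => ∃ α < ν, ∃ a ∈ V_ ν, B α a ⊆ X) (powerset (MS ν)) with hW
  have mem_W : ∀ {X}, X ∈ W ↔ X ⊆ MS ν ∧ ∃ α < ν, ∃ a ∈ V_ ν, B α a ⊆ X := by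
    intro X
    rw [hW, mem_sep, mem_powerset]
  have singleton_mem : ∀ {μ}, μ ∈ V_ ν → ({μ} : ZFSet.{u}) ∈ V_ ν := fun {μ} hμ => by
    rw [mem_vonNeumann, rank_singleton]
    exact hlim.succ_lt (mem_vonNeumann.1 hμ)
  have fiber_mem : ∀ μ ∈ MS ν, μ ∈ A → fiber ν b μ ∈ W := by
    intro μ hμ hμA
    refine mem_W.2 ⟨sep_subset, 0, hlim.bot_lt, {μ}, singleton_mem (hsub hμ), fun η hη => ?_⟩
    obtain ⟨h1, -, -, h4⟩ := mem_B.1 hη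
    refine mem_sep.2 ⟨h1, (mem_g η h1 μ (hsub hμ)).1 ((h4 μ (mem_singleton.2 rfl) ?_).2 hμA)⟩
    exact (mem_MS_iff_of_le hνκ (hsub hμ)).1 hμ
  refine ⟨W, ⟨⟨fun X hX => (mem_W.1 hX).1, ?_, ?_, ?_, ?_⟩, ?_, ?_, ?_, ?_⟩⟩
  · exact mem_W.2 ⟨fun _ h => h, 0, hlim.bot_lt, ∅, h0, B_sub _ _⟩
  · intro he
    obtain ⟨-, α, hα, a, ha, hsub'⟩ := mem_W.1 he
    obtain ⟨i, hi, hBi⟩ := B_large α hα a ha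
    rw [show B α a = ∅ from (ZFSet.eq_empty _).2 fun x hx => notMem_empty x (hsub' hx)] at hBi
    exact (hu.2.1 i hi).empty_notMem hBi
  · intro X hX Y hXY hY
    obtain ⟨-, α, hα, a, ha, hsub'⟩ := mem_W.1 hX
    exact mem_W.2 ⟨hY, α, hα, a, ha, fun x hx => hXY (hsub' hx)⟩
  · intro S hS hne hcard
    have hex : ∀ X, ∃ αa : Ordinal.{u} × ZFSet.{u}, X ∈ S →
        αa.1 < ν ∧ αa.2 ∈ V_ ν ∧ B αa.1 αa.2 ⊆ X := by
      intro X
      by_cases hX : X ∈ S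
      · obtain ⟨-, α, hα, a, ha, hsub'⟩ := mem_W.1 (hS hX)
        exact ⟨(α, a), fun _ => ⟨hα, ha, hsub'⟩⟩
      · exact ⟨(0, ∅), fun h => absurd h hX⟩
    choose c hc using hex
    obtain ⟨γ, hγ, hγα⟩ := hu.1.exists_bound hcard (fun X => (c X).1) fun X hX => (hc X hX).1
    obtain ⟨δ, hδ, hδa⟩ := hu.1.exists_bound hcard (fun X => rank (c X).2)
      fun X hX => mem_vonNeumann.1 (hc X hX).2.1
    refine mem_W.2 ⟨?_, γ, hγ, V_ δ, vonNeumann_mem_of_lt hδ, fun η hη => ?_⟩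
    · obtain ⟨X, hX⟩ := hne
      exact fun x hx => (mem_W.1 (hS hX)).1 (mem_of_mem_sInter hx hX)
    · refine (mem_sInter hne).2 fun X hX => (hc X hX).2.2 (B_mono (hγα X hX) ?_ hη)
      exact subset_vonNeumann.2 (hδa X hX)
  · intro α hα
    refine mem_W.2 ⟨sep_subset, α, hα, ∅, h0, fun η hη => ?_⟩
    obtain ⟨h1, -, h3, -⟩ := mem_B.1 hη
    obtain ⟨-, ν', l', u', -, -, rfl⟩ := mem_sep.1 h1
    rw [belowFirst_mkSeq, Ordinal.toZFSet_mem_toZFSet_iff] at h3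
    exact mem_sep.2 ⟨h1, ν', l', u', rfl, h3⟩
  · intro X hX
    obtain ⟨hXM, α, hα, a, ha, hsub'⟩ := mem_W.1 hX
    obtain ⟨i, hi, hBi⟩ := B_large α hα a ha
    have hXV : X ⊆ V_ ν := fun x hx => hsub (hXM hx)
    exact mem_sep.2 ⟨mem_powerset.2 hXV, i, hi, (hu.2.1 i hi).upward _ hBi X hsub' hXV⟩
  · intro μ hμ
    by_cases hμA : μ ∈ A
    · exact .inl (fiber_mem μ hμ hμA)
    · refine .inr (mem_W.2 ⟨fun x hx => (mem_sdiff.1 hx).1, 0, hlim.bot_lt, {μ},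
        singleton_mem (hsub hμ), fun η hη => ?_⟩)
      obtain ⟨h1, -, -, h4⟩ := mem_B.1 hη
      refine mem_sdiff.2 ⟨h1, fun hf => hμA ?_⟩
      refine (h4 μ (mem_singleton.2 rfl) ((mem_MS_iff_of_le hνκ (hsub hμ)).1 hμ)).1 ?_
      exact (mem_g η h1 μ (hsub hμ)).2 (mem_sep.1 hf).2
  · have hFV : filterValue ν W b ⊆ V_ ν := fun x hx => hsub (mem_sep.1 hx).1
    refine mem_sep.2 ⟨mem_powerset.2 hFV, fun i hi =>
      (hu.2.1 i hi).upward A (hA i hi) _ (fun μ hμ => ?_) hFV⟩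
    have hμ' : μ ∈ MS ν :=
      (mem_MS_iff_of_le hνκ ((hu.2.1 i hi).subset_of_mem A (hA i hi) hμ)).2 (hAT hμ)
    exact mem_sep.2 ⟨hμ', fiber_mem μ hμ' hμ⟩

/-! ### Reflection and repeat points -/

theorem IsMeasureSequence.take {κ ℓ τ : Ordinal.{u}} {U : Ordinal.{u} → ZFSet.{u}}
    (hU : IsMeasureSequence κ ℓ U) (hτ : τ ≤ ℓ) : IsMeasureSequence κ τ U := by
  obtain ⟨h1, h2, M, j, hM, hj, h3⟩ := hU
  exact ⟨h1, fun α hα => h2 α (hα.trans_le hτ), M, j, hM, hj, fun β hβ => h3 β (hβ.trans_le hτ)⟩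

/-- `J` generates the measures of `U`, as in the definition of a measure sequence. -/
structure Generates (J : ZFSet.{u} → ZFSet.{u}) (κ ℓ : Ordinal.{u})
    (U : Ordinal.{u} → ZFSet.{u}) : Prop where
  elementary : IsDeltaZeroElementary J
  fixes : ∀ x ∈ V_ κ, J x = x
  fixes_ordinal : ∀ α < κ, J α.toZFSet = α.toZFSet
  mem_iff : ∀ β < ℓ, ∀ X, X ∈ U β ↔ X ⊆ V_ κ ∧ mkSeq κ β U ∈ J X

theorem IsMeasureSequence.exists_generates {κ ℓ : Ordinal.{u}} {U : Ordinal.{u} → ZFSet.{u}}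
    (hU : IsMeasureSequence κ ℓ U) : ∃ J, Generates J κ ℓ U := by
  obtain ⟨h1, h2, M, j, hM, hj, h3⟩ := hU
  have hJ := isDeltaZeroElementary_coe hM j
  exact ⟨_, hJ, fun x hx => hJ.apply_eq_self hj.1 h1.isSuccLimit.isSuccPrelimit hx, hj.1,
    fun β hβ => (h3 β hβ).2⟩

namespace Generates

variable {J : ZFSet.{u} → ZFSet.{u}} {κ ℓ : Ordinal.{u}} {U : Ordinal.{u} → ZFSet.{u}}

theorem mem_image_iff (hJ : Generates J κ ℓ U) {x T : ZFSet.{u}} (hx : x ∈ V_ κ) :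
    x ∈ J T ↔ x ∈ T := by
  have h := hJ.elementary.mem_iff (a := x) (b := T)
  rwa [hJ.fixes x hx] at h

theorem pair_mem_image_iff (hJ : Generates J κ ℓ U) {x y g : ZFSet.{u}} (hx : x ∈ V_ κ)
    (hy : y ∈ V_ κ) : pair x y ∈ J g ↔ pair x y ∈ g := by
  have h := hJ.elementary.mem_iff (a := pair x y) (b := g)
  rwa [hJ.elementary.pair, hJ.fixes x hx, hJ.fixes y hy] at h

/-- The measure `U_τ` concentrates on the sequences with the combinatorial property if and only
if `U ↾ τ` has the property. -/
theorem combWRP_set_mem_iff (hJ : Generates J κ ℓ U) (hU : ∀ i < ℓ, IsMeasureOn κ (U i))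
    {T : ZFSet.{u}} (hTV : T ⊆ V_ κ) {τ : Ordinal.{u}} (hτ : τ < ℓ) (hT : T ∈ U τ) :
    ZFSet.sep (fun s => CombWRP T s) T ∈ U τ ↔ CombWRP T (mkSeq κ τ U) := by
  have hUτ : ∀ i < τ, IsMeasureOn κ (U i) := fun i hi => hU i (hi.trans hτ)
  set S := ZFSet.sep (fun s => CombWRP T s) T with hS
  have hSV : S ⊆ V_ κ := fun x hx => hTV (sep_subset hx)
  constructor
  · intro h g hg
    have h1 := (hJ.elementary.transfer S T g ∅ ∅ ∅
      (R := fun S T g _ _ _ => ∀ s ∈ S, HasGuess T s g) (.ball 0 (.hasGuess 2 0 3))).1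
      (fun s hs => (mem_sep.1 hs).2 g hg) _ ((hJ.mem_iff τ hτ S).1 h).2
    exact HasGuess.congr hUτ (fun x hx => hJ.mem_image_iff hx)
      (fun x hx y hy => hJ.pair_mem_image_iff hx hy) h1
  · intro h
    by_contra hSU
    -- Otherwise `U_τ` concentrates on the sequences without the property. Each of them has a
    -- counterexample `c s`, and elementarity yields a counterexample for `U ↾ τ`.
    have hdiff : V_ κ \ S ∈ U τ := ((hU τ hτ).ultra S hSV).resolve_left hSU
    have hex : ∀ s, ∃ g, ¬ CombWRP T s → CodesMeasureFunction T g ∧ ¬ HasGuess T s g := by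
      intro s
      by_cases hs : CombWRP T s
      · exact ⟨∅, fun h => absurd hs h⟩
      · obtain ⟨g, hg⟩ := not_forall.1 hs
        exact ⟨g, fun _ => Classical.not_imp.1 hg⟩
    choose c hc using hex
    let _ : Definable₁ c := Classical.allZFSetDefinable _
    have h1 := (hJ.elementary.transfer (V_ κ \ S) T (ZFSet.image c T) ∅ ∅ ∅
      (R := fun D T K _ _ _ => ∀ s ∈ D, s ∈ T →
        ∃ g ∈ K, CodesMeasureFunction T g ∧ ¬ HasGuess T s g)
      (.ball 0 (.imp (.mem 0 2) (.bex 3 (.and (.codesMeasureFunction 3 0)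
        (.not (.hasGuess 3 1 0))))))).1
      (fun s hs hsT => ⟨c s, mem_image.2 ⟨s, hsT, rfl⟩,
        hc s fun hw => (mem_sdiff.1 hs).2 (mem_sep.2 ⟨hsT, hw⟩)⟩)
      _ ((hJ.mem_iff τ hτ _).1 hdiff).2 ((hJ.mem_iff τ hτ _).1 hT).2
    obtain ⟨g, -, hg, hng⟩ := h1
    refine hng (HasGuess.congr hUτ (fun x hx => (hJ.mem_image_iff hx).symm)
      (fun _ _ _ _ => Iff.rfl) (h g fun η hη => hg η ((hJ.mem_image_iff (hTV hη)).2 hη)))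

/-- For a repeat point `ρ` and a measure function `b`, the set `j(b)(U ↾ ρ)` is a guess, both for
`U` and for `U ↾ ρ`. By elementarity it is in `U_i` for `i < ρ`, hence for all `i` because `ρ` is
a repeat point, and the sets of agreement are in `U_ρ`, hence in some `U_i` with `i < ρ`. -/
theorem combWRP_of_isRepeatPoint (hJ : Generates J κ ℓ U) (hκ : IsMeasurableCardinal κ)
    (hU : ∀ i < ℓ, IsMeasureOn κ (U i)) {T : ZFSet.{u}} (hTV : T ⊆ V_ κ)
    (hT : ∀ i < ℓ, T ∈ U i) {ρ : Ordinal.{u}} (hρ : IsRepeatPoint κ ℓ U ρ) {m : Ordinal.{u}}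
    (hρm : ρ ≤ m) (hm : m ≤ ℓ) : CombWRP T (mkSeq κ m U) := by
  intro g hg
  obtain ⟨hρℓ, hrep⟩ := hρ
  set s := mkSeq κ ρ U with hs
  have hsT : s ∈ J T := ((hJ.mem_iff ρ hρℓ T).1 (hT ρ hρℓ)).2
  set A := ZFSet.sep (fun μ => pair s μ ∈ J g) T with hA
  have hAV : A ⊆ V_ κ := fun x hx => hTV (sep_subset hx)
  have hg' := (hJ.elementary.transfer T g ∅ ∅ ∅ ∅
    (R := fun T g _ _ _ _ => CodesMeasureFunction T g) (.codesMeasureFunction 0 1)).1 hg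
  have hA1 : ∀ i < ρ, A ∈ U i := by
    intro i hi
    have hUi := hU i (hi.trans hρℓ)
    obtain ⟨X, hX, hXg⟩ := hg' s hsT (U i) (isEntry_mkSeq.2 ⟨i, hi, rfl⟩)
    refine hUi.upward _ (hUi.inter_mem hκ.aleph0_le hX (hT i (hi.trans hρℓ))) _
      (fun x hx => ?_) hAV
    exact mem_sep.2 ⟨(mem_inter.1 hx).2, hXg x (mem_inter.1 hx).1⟩
  have hA2 : ∀ i < ℓ, A ∈ U i := by
    intro i hi
    rcases lt_or_ge i ρ with h | h
    · exact hA1 i h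
    refine ((hU i hi).ultra A hAV).resolve_right fun hc => ?_
    obtain ⟨-, k, hk, hck⟩ := mem_sep.1 (hrep i h hi hc)
    have hUk := hU k (hk.trans hρℓ)
    have he := hUk.inter_mem hκ.aleph0_le (hA1 k hk) hck
    rw [show A ∩ (V_ κ \ A) = ∅ from (ZFSet.eq_empty _).2 fun x hx =>
      (mem_sdiff.1 (mem_inter.1 hx).2).2 (mem_inter.1 hx).1] at he
    exact hUk.empty_notMem he
  obtain ⟨-, i₀, hi₀, -⟩ := mem_sep.1 (hrep ρ le_rfl hρℓ (hU ρ hρℓ).base_mem)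
  refine (hasGuess_mkSeq fun i hi => hU i (hi.trans_le hm)).2
    ⟨(pos_of_gt hi₀).trans_le hρm, A, sep_subset, fun i hi => hA2 i (hi.trans_le hm),
      fun α hα a ha => ?_⟩
  set B := ZFSet.sep (fun η => Agrees T g A α.toZFSet a η) T with hB
  have hBV : B ⊆ V_ κ := fun x hx => hTV (sep_subset hx)
  have h1 := (hJ.elementary.transfer T g A α.toZFSet a B
    (R := fun T g A α a B => ∀ η ∈ T, Agrees T g A α a η → η ∈ B)
    (.ball 0 (.imp (.agrees 1 2 3 4 5 0) (.mem 0 6)))).1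
    (fun η hη h => mem_sep.2 ⟨hη, h⟩) s hsT (by
      refine ⟨hsT, ?_, fun μ hμ hμT => ?_⟩
      · rw [hJ.fixes_ordinal α hα]
        exact belowFirst_mkSeq.2 (Ordinal.toZFSet_mem_toZFSet_iff.2 hα)
      · rw [hJ.fixes a ha] at hμ
        have hμV := (isTransitive_vonNeumann κ).mem_trans hμ ha
        rw [hJ.mem_image_iff hμV] at hμT ⊢
        simp [hA, mem_sep, hμT])
  have hBρ : B ∈ U ρ := (hJ.mem_iff ρ hρℓ B).2 ⟨hBV, h1⟩
  obtain ⟨-, i, hi, hBi⟩ := mem_sep.1 (hrep ρ le_rfl hρℓ hBρ)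
  exact ⟨i, hi.trans_le hρm, B, hBi, fun η hη => (mem_sep.1 hη).2⟩

end Generates

end Radin

theorem mainTheorem7 (κ ℓ : Ordinal.{u}) (U : Ordinal.{u} → ZFSet.{u})
    (hU : Radin.IsMeasureSequence κ ℓ U)
    (hMS : Radin.MS κ ∈ Radin.interSeq κ ℓ U) :
    (Radin.RP κ ℓ U → Radin.WRP κ ℓ U) ∧
      ∀ ρ, Radin.IsRepeatPoint κ ℓ U ρ →
        Radin.wrpSet κ ∈ U ρ ∧ ∃ τ < ρ, Radin.WRP κ τ U := by
  obtain ⟨J, hJ⟩ := hU.exists_generates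
  have hTV : Radin.MS κ ⊆ V_ κ := sep_subset
  have hT := (mem_sep.1 hMS).2
  refine ⟨?_, fun ρ hρ => ?_⟩
  · rintro ⟨ρ, hρ⟩
    exact Radin.WRP_of_combWRP le_rfl hU
      (hJ.combWRP_of_isRepeatPoint hU.1 hU.2.1 hTV hT hρ hρ.1.le le_rfl)
  · have hS := (hJ.combWRP_set_mem_iff hU.2.1 hTV hρ.1 (hT ρ hρ.1)).2
      (hJ.combWRP_of_isRepeatPoint hU.1 hU.2.1 hTV hT hρ le_rfl hρ.1.le)
    refine ⟨(hU.2.1 ρ hρ.1).upward _ hS _ (fun s hs => ?_) fun s hs => hTV (sep_subset hs), ?_⟩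
    · obtain ⟨hsT, hw⟩ := mem_sep.1 hs
      obtain ⟨-, ν, l, u, hν, hu, rfl⟩ := mem_sep.1 hsT
      exact mem_sep.2 ⟨hsT, ν, l, u, rfl, Radin.WRP_of_combWRP hν.le hu hw⟩
    · obtain ⟨-, τ, hτ, hSτ⟩ := mem_sep.1 (hρ.2 ρ le_rfl hρ.1 hS)
      have hτℓ := hτ.trans hρ.1
      exact ⟨τ, hτ, Radin.WRP_of_combWRP le_rfl (hU.take hτℓ.le)
        ((hJ.combWRP_set_mem_iff hU.2.1 hTV hτℓ (hT τ hτℓ)).1 hSτ)⟩
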